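/- Let $(W_k)_{k\ge 0}$ be the random walk on $\mathbb{Z}^2$ started at $W_0=(0,0)$ whose steps are $(1,0)$, $(0,1)$ and $(0,-1)$, each taken with probability $1/3$ (the 3N random walk). Let $p_k(t,s)=\mathrm{P}(W_k=(t,s))$ and let $$g_3(t,s,a)=\sum_{k=0}^\infty a^k p_k(t,s),\qquad (t,s)\in\mathbb{Z}^2,\ a\in[0,1),$$ be its lattice Green function. For $t>0$, $s\in\mathbb{R}$, $z>0$ put $$h_3(t,s,z)=\frac{3}{2\sqrt{\pi t}}\,e^{-3zt-\frac{s^2}{4t}},\qquad \bar h_3(t,s,z)=\frac{1}{\sqrt t}\,e^{-zt-\frac{s^2}{16t}},$$ and let $[x]$ denote the integer part (floor) of $x\in\mathbb{R}$. (i) For every $(t,s,z)\in(0,\infty)\times\mathbb{R}\times(0,\infty)$, $$\sqrt{\lambda}\,g_3\Big([\lambda t],[\sqrt{\lambda}\,s],1-\frac{z}{\lambda}\Big)\longrightarrow h_3(t,s,z)\qquad\text{as } \lambda\to\infty,\ \lambda \in \mathbb{R}.$$ (ii) For every $\epsilon>0$ this convergence is uniform on the set $\{(t,s,z):\ \epsilon<t<1/\epsilon,\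 \epsilon<|s|<1/\epsilon,\ \epsilon<z<1/\epsilon\}$. (iii) There exist constants $C,c>0$ such that for all sufficiently large $\lambda$ and all $t>0$, $s\in\mathbb{R}$, $0<z<\lambda$, $$\sqrt{\lambda}\,g_3\Big([\lambda t],[\sqrt{\lambda}\,s],1-\frac{z}{\lambda}\Big)<C\Big(\bar h_3(t,s,z)+\sqrt{\lambda}\,e^{-zt-c(\lambda t)^{1/3}-c(\sqrt{\lambda}\,|s|)^{1/2}}\Big).$$ -/

import Mathlib

open Real Filter Topology

namespace ThreeN

noncomputable section

/-- One step of the 3N random walk on `ℤ²`: from any site the walk moves by `(1, 0)`, `(0, 1)` or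
`(0, -1)`, each with probability `1 / 3`. -/
def stepLaw : PMF (ℤ × ℤ) :=
  PMF.uniformOfFinset {((1 : ℤ), (0 : ℤ)), (0, 1), (0, -1)} (by simp)

/-- The law of the position `W_k` of the 3N random walk started at `W_0 = (0, 0)`. -/
def walkLaw : ℕ → PMF (ℤ × ℤ)
  | 0 => PMF.pure (0, 0)
  | k + 1 => (walkLaw k).bind fun w => stepLaw.map fun x => w + x

/-- The `k`-step probability `p_k(t, s) = P(W_k = (t, s) | W_0 = (0, 0))`. -/
def stepProb (k : ℕ) (t s : ℤ) : ℝ :=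
  (walkLaw k (t, s)).toReal

/-- The lattice Green function `g₃(t, s, a) = ∑_{k ≥ 0} a^k p_k(t, s)`, for `a ∈ [0, 1)`. -/
def g3 (t s : ℤ) (a : ℝ) : ℝ :=
  ∑' k : ℕ, a ^ k * stepProb k t s

/-- The series defining `g₃` converges for every `a ∈ [0, 1)`. -/
theorem summable_g3 (t s : ℤ) {a : ℝ} (h0 : 0 ≤ a) (h1 : a < 1) :
    Summable fun k : ℕ => a ^ k * stepProb k t s := by
  refine Summable.of_nonneg_of_le
    (fun k => mul_nonneg (pow_nonneg h0 k) ENNReal.toReal_nonneg) (fun k => ?_)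
    (summable_geometric_of_lt_one h0 h1)
  have h : stepProb k t s ≤ 1 :=
    ENNReal.toReal_le_of_le_ofReal zero_le_one (by simpa using PMF.coe_le_one (walkLaw k) (t, s))
  exact mul_le_of_le_one_right (pow_nonneg h0 k) h

/-- The limit function `h₃(t, s, z)`, for `t > 0`, `s ∈ ℝ`, `z > 0`. -/
def h3 (t s z : ℝ) : ℝ :=
  3 / (2 * √(π * t)) * exp (-3 * z * t - s ^ 2 / (4 * t))

/-- The dominating function `h̄₃(t, s, z)`, for `t > 0`, `s ∈ ℝ`, `z > 0`. -/
def h3bar (t s z : ℝ) : ℝ :=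
  1 / √t * exp (-z * t - s ^ 2 / (16 * t))

/-- The rescaled Green function `√Λ g₃([Λ t], [√Λ s], 1 - z / Λ)`. -/
def scaledGreen (Λ t s z : ℝ) : ℝ :=
  √Λ * g3 ⌊Λ * t⌋ ⌊√Λ * s⌋ (1 - z / Λ)

end

end ThreeN

namespace ThreeN
-- A Fourier transform in the second coordinate turns `p_k(n, m)` into the integral of `choose k n *
-- (2 cos θ)^(k - n) / 3^k`, and the negative binomial series sums over `k`. Thus `g₃(n, m, a)` is
-- the `m`-th Fourier coefficient of `(3/a) (3/a - 2 cos θ)^(-(n+1))` (`ofReal_g3_eq_integral`).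
--
-- For the limit, substitute `θ = x/√Λ`. The kernel tends to `3 exp(-(3z + x²)t)`, whose inverse
-- Fourier transform is `h₃`; Bernoulli's inequality dominates it by a Cauchy density. The limit is
-- taken jointly in `(Λ, t, s, z)` (`tendsto_scaledGreen`), which is locally uniform convergence,
-- hence uniform on compact sets.
--
-- For the bound, at least `n` steps are needed to reach abscissa `n`, so `g₃ ≤ a^n ∑ p_k`. The sum
-- at `a = 1` is estimated by moving the contour to height `u`, and `u` is optimised in
-- `tsum_stepProb_floor_le`.
theorem stepProb_succ (k : ℕ) (t s : ℤ) : stepProb (k + 1) t s =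
    (stepProb k (t - 1) s + stepProb k t (s - 1) + stepProb k t (s + 1)) / 3 := by
  have hmap (x : ℤ × ℤ) : ((walkLaw k).map fun w => w + x) (t, s) = walkLaw k ((t, s) - x) := by
    rw [PMF.map_apply, tsum_eq_single ((t, s) - x)]
    · simp
    · intro w hw
      rw [if_neg]
      rintro h
      exact hw (by rw [h]; simp)
  have h : walkLaw (k + 1) = stepLaw.bind fun x => (walkLaw k).map fun w => w + x := by
    rw [walkLaw]
    simp only [PMF.map, Function.comp_def]
    exact PMF.bind_comm _ _ _
  have hfin (a : ℤ × ℤ) : walkLaw k a ≠ ⊤ := PMF.apply_ne_top _ _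
  rw [stepProb, h, PMF.bind_apply,
    tsum_eq_sum (s := {((1 : ℤ), (0 : ℤ)), (0, 1), (0, -1)})]
  · simp only [hmap, stepLaw]
    rw [Finset.sum_insert (by decide), Finset.sum_insert (by decide), Finset.sum_singleton]
    simp [stepProb, PMF.uniformOfFinset_apply, ENNReal.toReal_add, ENNReal.mul_eq_top, hfin]
    ring
  · intro x hx
    rw [stepLaw, PMF.uniformOfFinset_apply_of_notMem _ hx, zero_mul]

theorem stepProb_zero (t s : ℤ) : stepProb 0 t s = if t = 0 ∧ s = 0 then 1 else 0 := by
  simp only [stepProb, walkLaw, PMF.pure_apply, Prod.mk.injEq]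
  split_ifs <;> simp

theorem stepProb_of_neg (k : ℕ) {t : ℤ} (s : ℤ) (ht : t < 0) : stepProb k t s = 0 := by
  induction k generalizing t s with
  | zero => rw [stepProb_zero, if_neg (by omega)]
  | succ k ih => rw [stepProb_succ, ih _ ht, ih _ ht, ih _ (by omega)]; simp

theorem stepProb_nonneg (k : ℕ) (t s : ℤ) : 0 ≤ stepProb k t s := ENNReal.toReal_nonneg

/-! ### Fourier representation of the step probabilities and of the Green function -/

theorem integral_cexp_int_mul (m : ℤ) (v : ℝ) :
    ∫ θ in -π..π, Complex.exp (-Complex.I * m * (θ + v * Complex.I)) =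
      if m = 0 then 2 * (π : ℂ) else 0 := by
  split_ifs with h
  · subst h
    simp
    ring
  · have hc : -Complex.I * m ≠ 0 := by simp [h]
    have h1 (θ : ℝ) : Complex.exp (-Complex.I * m * (θ + v * Complex.I)) =
        Complex.exp (m * v) * Complex.exp (-Complex.I * m * θ) := by
      rw [← Complex.exp_add]
      congr 1
      linear_combination (-(m : ℂ) * v) * Complex.I_sq
    simp_rw [h1]
    rw [intervalIntegral.integral_const_mul, integral_exp_mul_complex hc]
    have h2 : Complex.exp (-Complex.I * m * (π : ℝ)) =
        Complex.exp (-Complex.I * m * ((-π : ℝ) : ℂ)) := by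
      rw [Complex.exp_eq_exp_iff_exists_int]
      exact ⟨-m, by push_cast; ring⟩
    rw [h2, sub_self, zero_div, mul_zero]

/-- The Fourier integral representation of the `k`-step probabilities, along the horizontal line
of height `v` in the complex plane. -/
theorem stepProb_eq_integral (k n : ℕ) (m : ℤ) (v : ℝ) :
    (stepProb k n m : ℂ) = 1 / (2 * π) * ∫ θ in -π..π, (k.choose n : ℂ) / 3 ^ k *
      (2 * Complex.cos (θ + v * Complex.I)) ^ (k - n) *
        Complex.exp (-Complex.I * m * (θ + v * Complex.I)) := by
  have hpi : (π : ℂ) ≠ 0 := by exact_mod_cast pi_ne_zero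
  induction k generalizing n m with
  | zero =>
    rw [stepProb_zero]
    rcases Nat.eq_zero_or_pos n with rfl | hn
    · simp only [Nat.choose_self, Nat.cast_one, pow_zero, mul_one, one_mul, div_one,
        integral_cexp_int_mul, Nat.cast_zero, true_and, Nat.sub_self]
      split_ifs <;> simp
      field_simp
    · simp [Nat.choose_eq_zero_of_lt hn, hn.ne']
  | succ k ih =>
    have hint (n : ℕ) (m : ℤ) : IntervalIntegrable (fun θ : ℝ => (k.choose n : ℂ) / 3 ^ k *
        (2 * Complex.cos (θ + v * Complex.I)) ^ (k - n) *
          Complex.exp (-Complex.I * m * (θ + v * Complex.I))) MeasureTheory.volume (-π) π :=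
      (by fun_prop : Continuous _).intervalIntegrable _ _
    have hexp (θ : ℝ) : Complex.exp (-Complex.I * (m - 1 : ℤ) * (θ + v * Complex.I)) +
        Complex.exp (-Complex.I * (m + 1 : ℤ) * (θ + v * Complex.I)) =
        2 * Complex.cos (θ + v * Complex.I) *
          Complex.exp (-Complex.I * m * (θ + v * Complex.I)) := by
      rw [Complex.two_cos, add_mul, ← Complex.exp_add, ← Complex.exp_add]
      push_cast
      congr 2 <;> ring
    -- For `n > k` the subtraction truncates, but then the binomial coefficient vanishes.
    have hpow (θ : ℝ) : (k.choose n : ℂ) * ((2 * Complex.cos (θ + v * Complex.I)) ^ (k - n) *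
        (2 * Complex.cos (θ + v * Complex.I))) =
        (k.choose n : ℂ) * (2 * Complex.cos (θ + v * Complex.I)) ^ (k + 1 - n) := by
      rcases le_or_gt n k with h | h
      · rw [← pow_succ, Nat.sub_add_comm h]
      · simp [Nat.choose_eq_zero_of_lt h]
    rw [stepProb_succ]
    push_cast
    rw [ih n, ih n]
    rcases n with _ | n
    · rw [stepProb_of_neg k m (by simp), Complex.ofReal_zero, zero_add, ← mul_add,
        ← intervalIntegral.integral_add (hint _ _) (hint _ _), mul_div_assoc,
        ← intervalIntegral.integral_div]
      congr 2 with θ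
      rw [← mul_add, hexp]
      have := hpow θ
      simp only [Nat.choose_zero_right, Nat.sub_zero, Nat.cast_one, one_mul] at this ⊢
      rw [← this]
      ring
    · have h0 : ((n + 1 : ℕ) : ℤ) - 1 = n := by push_cast; ring
      rw [h0, ih n, ← mul_add, ← mul_add,
        ← intervalIntegral.integral_add (hint _ _) (hint _ _),
        ← intervalIntegral.integral_add ((hint _ _).add (hint _ _)) (hint _ _), mul_div_assoc,
        ← intervalIntegral.integral_div]
      congr 2 with θ
      rw [add_assoc, ← mul_add, hexp, Nat.choose_succ_succ, Nat.cast_add]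
      have := hpow θ
      rw [show k + 1 - (n + 1) = k - n by omega] at this ⊢
      linear_combination (1 / 3 ^ k / 3 * Complex.exp (-Complex.I * m * (θ + v * Complex.I))) * this

theorem stepProb_of_lt {k n : ℕ} (m : ℤ) (h : k < n) : stepProb k n m = 0 := by
  have := stepProb_eq_integral k n m 0
  simpa [Nat.choose_eq_zero_of_lt h] using this

theorem norm_cos_add_mul_I_le (θ v : ℝ) : ‖Complex.cos (θ + v * Complex.I)‖ ≤ cosh v := by
  rw [Complex.cos, cosh_eq, norm_div, Complex.norm_ofNat, add_comm (rexp v)]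
  gcongr
  refine (norm_add_le _ _).trans_eq ?_
  simp [Complex.norm_exp]

theorem norm_cexp_neg_I_mul (m : ℤ) (θ v : ℝ) :
    ‖Complex.exp (-Complex.I * m * (θ + v * Complex.I))‖ = exp (m * v) := by
  rw [Complex.norm_exp]
  simp

/-- The Fourier integral representation of the lattice Green function. -/
theorem hasSum_pow_mul_stepProb (n : ℕ) (m : ℤ) {a v : ℝ} (ha0 : 0 ≤ a) (ha1 : a ≤ 1)
    (hv : 2 * cosh v < 3) :
    HasSum (fun k : ℕ => ((a ^ k * stepProb k n m : ℝ) : ℂ))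
      (1 / (2 * π) * ∫ θ in -π..π, ((a : ℂ) / 3) ^ n /
        (1 - a / 3 * (2 * Complex.cos (θ + v * Complex.I))) ^ (n + 1) *
          Complex.exp (-Complex.I * m * (θ + v * Complex.I))) := by
  have hz : ∑ k ∈ Finset.range n, ((a ^ k * stepProb k n m : ℝ) : ℂ) = 0 :=
    Finset.sum_eq_zero fun k hk => by simp [stepProb_of_lt m (Finset.mem_range.1 hk)]
  have hr : ‖2 * cosh v / 3‖ < 1 := by
    rw [Real.norm_of_nonneg (by positivity)]
    linarith
  have hnorm (θ : ℝ) : ‖(a : ℂ) / 3 * (2 * Complex.cos (θ + v * Complex.I))‖ ≤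
      2 * cosh v / 3 := by
    rw [norm_mul, norm_mul, norm_div, Complex.norm_real, Real.norm_of_nonneg ha0]
    have := norm_cos_add_mul_I_le θ v
    have h0 : 0 ≤ ‖Complex.cos (θ + v * Complex.I)‖ := norm_nonneg _
    simp only [Complex.norm_ofNat]
    nlinarith
  have key := intervalIntegral.hasSum_integral_of_dominated_convergence (a := -π) (b := π)
    (μ := MeasureTheory.volume)
    (F := fun (j : ℕ) (θ : ℝ) => ((a : ℂ) / 3) ^ n * (((j + n).choose n : ℂ) *
      ((a : ℂ) / 3 * (2 * Complex.cos (θ + v * Complex.I))) ^ j) *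
        Complex.exp (-Complex.I * m * (θ + v * Complex.I)))
    (f := fun θ : ℝ => ((a : ℂ) / 3) ^ n *
        (1 / (1 - a / 3 * (2 * Complex.cos (θ + v * Complex.I))) ^ (n + 1)) *
          Complex.exp (-Complex.I * m * (θ + v * Complex.I)))
    (fun j _ => ‖(a : ℂ) / 3‖ ^ n * (((j + n).choose n : ℝ) * (2 * cosh v / 3) ^ j) *
      exp (m * v))
    (fun j => (by fun_prop : Continuous _).aestronglyMeasurable)
    (fun j => MeasureTheory.ae_of_all _ fun θ _ => by
      rw [norm_mul, norm_mul, norm_mul, norm_pow, norm_pow, norm_cexp_neg_I_mul,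
        Complex.norm_natCast]
      have := hnorm θ
      gcongr)
    (MeasureTheory.ae_of_all _ fun θ _ =>
      ((hasSum_choose_mul_geometric_of_norm_lt_one n hr).summable.mul_left _).mul_right _)
    (by simp)
    (MeasureTheory.ae_of_all _ fun θ _ => ((hasSum_choose_mul_geometric_of_norm_lt_one n
      ((hnorm θ).trans_lt (by linarith))).mul_left _).mul_right _)
  have key' := key.mul_left (1 / (2 * (π : ℂ)))
  -- The series runs over `j = k - n`; the terms with `k < n` are zero by `hz`.
  have hF (j : ℕ) : 1 / (2 * (π : ℂ)) * (∫ θ in -π..π, ((a : ℂ) / 3) ^ n *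
      (((j + n).choose n : ℂ) * ((a : ℂ) / 3 * (2 * Complex.cos (θ + v * Complex.I))) ^ j) *
        Complex.exp (-Complex.I * m * (θ + v * Complex.I))) =
      ((a ^ (j + n) * stepProb (j + n) n m : ℝ) : ℂ) := by
    rw [Complex.ofReal_mul, stepProb_eq_integral _ n m v, mul_left_comm]
    congr 1
    rw [← intervalIntegral.integral_const_mul]
    congr 1 with θ
    rw [Nat.add_sub_cancel, pow_add 3, mul_pow _ (2 * Complex.cos _), div_pow, div_pow]
    push_cast
    ring
  simp only [hF, mul_one_div] at key'
  have := (hasSum_nat_add_iff (f := fun k : ℕ => ((a ^ k * stepProb k n m : ℝ) : ℂ)) n).1 key'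
  rwa [hz, add_zero] at this

theorem ofReal_g3_eq_integral (n : ℕ) (m : ℤ) {a : ℝ} (ha0 : 0 < a) (ha1 : a ≤ 1) :
    (g3 n m a : ℂ) = 1 / (2 * π) * ∫ θ in -π..π,
      ((3 / a * ((3 / a - 2 * cos θ) ^ (n + 1))⁻¹ : ℝ) : ℂ) *
        Complex.exp (-Complex.I * m * θ) := by
  have h := (hasSum_pow_mul_stepProb n m (v := 0) ha0.le ha1 (by norm_num)).tsum_eq
  rw [g3, Complex.ofReal_tsum, h]
  congr 2 with θ
  have h1 : (a : ℂ) ≠ 0 := by exact_mod_cast ha0.ne'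
  simp only [Complex.ofReal_zero, zero_mul, add_zero]
  congr 1
  have h2 : (1 : ℂ) - a / 3 * (2 * Complex.cos θ) = a / 3 * (3 / a - 2 * Complex.cos θ) := by
    field_simp
  rw [h2, mul_pow]
  push_cast
  rw [pow_succ ((a : ℂ) / 3), div_eq_mul_inv, mul_inv, mul_inv]
  have h3 : ((a : ℂ) / 3) ^ n ≠ 0 := pow_ne_zero _ (div_ne_zero h1 three_ne_zero)
  field_simp

/-- The substitution `θ = x/√Λ` absorbs the factor `√Λ`; the indicator keeps the domain of
integration fixed for dominated convergence. -/
theorem sqrt_mul_g3_eq_integral (n : ℕ) (m : ℤ) {a Λ : ℝ} (ha0 : 0 < a) (ha1 : a ≤ 1) :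
    ((√Λ * g3 n m a : ℝ) : ℂ) = 1 / (2 * π) * ∫ x : ℝ, (Set.Ioc (-π) π).indicator (fun θ : ℝ =>
      ((3 / a * ((3 / a - 2 * cos θ) ^ (n + 1))⁻¹ : ℝ) : ℂ) *
        Complex.exp (-Complex.I * m * θ)) (x / √Λ) := by
  rw [MeasureTheory.Measure.integral_comp_div, abs_of_nonneg (sqrt_nonneg _),
    MeasureTheory.integral_indicator measurableSet_Ioc, Complex.ofReal_mul,
    ofReal_g3_eq_integral n m ha0 ha1, intervalIntegral.integral_of_le (by linarith [pi_pos]),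
    Complex.real_smul]
  ring

/-! ### Bounds and limits of the rescaled kernel -/

/-- Combines `cos θ ≤ 1 - 2θ²/π²` with Bernoulli's inequality; `c ≥ 1` gives `c ≥ 3 - 2c`, so that
`3 - 2c` factors out. It serves both the dominated convergence (`c = 1`) and the shifted contour (`c
= cosh u`). -/
theorem one_add_le_three_sub_pow {c θ : ℝ} (N : ℕ) (hc1 : 1 ≤ c) (hc2 : 2 * c < 3)
    (hθ : |θ| ≤ π) :
    (3 - 2 * c) ^ N * (1 + N * (4 / π ^ 2 * θ ^ 2)) ≤ (3 - 2 * c * cos θ) ^ N := by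
  have h1 := cos_le_one_sub_mul_cos_sq hθ
  have h2 : 0 ≤ 2 / π ^ 2 * θ ^ 2 := by positivity
  have h4 : 0 ≤ 4 / π ^ 2 * θ ^ 2 := by positivity
  have h3 : (3 - 2 * c) * (1 + 4 / π ^ 2 * θ ^ 2) ≤ 3 - 2 * c * cos θ := by
    have : 4 / π ^ 2 * θ ^ 2 = 2 * (2 / π ^ 2 * θ ^ 2) := by ring
    rw [this]
    nlinarith
  calc (3 - 2 * c) ^ N * (1 + N * (4 / π ^ 2 * θ ^ 2))
      ≤ (3 - 2 * c) ^ N * (1 + 4 / π ^ 2 * θ ^ 2) ^ N :=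
        mul_le_mul_of_nonneg_left (one_add_mul_le_pow (by linarith) N)
          (pow_nonneg (by linarith) _)
    _ ≤ _ := by
        rw [← mul_pow]
        exact pow_le_pow_left₀ (mul_nonneg (by linarith) (by linarith)) h3 N

theorem tendsto_inv_one_add_pow {ι : Type*} {l : Filter ι} {N : ι → ℕ} {w : ι → ℝ} {y : ℝ}
    (hw : ∀ᶠ i in l, 0 ≤ w i) (hw0 : Tendsto w l (𝓝 0))
    (hNw : Tendsto (fun i => N i * w i) l (𝓝 y)) :
    Tendsto (fun i => ((1 + w i) ^ N i)⁻¹) l (𝓝 (exp (-y))) := by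
  have h1 : Tendsto (fun i => N i * log (1 + w i)) l (𝓝 y) := by
    have h2 : Tendsto (fun i => N i * w i * (1 + w i)⁻¹) l (𝓝 y) := by
      have h3 : Tendsto (fun i => (1 + w i)⁻¹) l (𝓝 1) := by
        simpa using (hw0.const_add 1).inv₀ (by simp)
      simpa using hNw.mul h3
    -- Squeeze by `w/(1 + w) ≤ log(1 + w) ≤ w`.
    refine tendsto_of_tendsto_of_tendsto_of_le_of_le' h2 hNw ?_ ?_
    · filter_upwards [hw] with i hi
      have h4 := one_sub_inv_le_log_of_pos (by linarith : 0 < 1 + w i)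
      have h5 : w i * (1 + w i)⁻¹ = 1 - (1 + w i)⁻¹ := by
        field_simp
        ring
      rw [mul_assoc, h5]
      gcongr
    · filter_upwards [hw] with i hi
      have h4 := log_le_sub_one_of_pos (by linarith : 0 < 1 + w i)
      gcongr
      linarith
  refine ((continuous_exp.tendsto _).comp h1.neg).congr' ?_
  filter_upwards [hw] with i hi
  rw [Function.comp_apply, exp_neg, mul_comm, ← rpow_def_of_pos (by linarith), rpow_natCast]

theorem tendsto_mul_two_sub_cos {ι : Type*} {l : Filter ι} {Λ : ι → ℝ} (hΛ : Tendsto Λ l atTop)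
    (x : ℝ) : Tendsto (fun i => Λ i * (2 - 2 * cos (x / √(Λ i)))) l (𝓝 (x ^ 2)) := by
  have h0 : Tendsto (fun i => 10 / 96 * x ^ 4 * (Λ i)⁻¹) l (𝓝 0) := by
    simpa using (tendsto_inv_atTop_zero.comp hΛ).const_mul (10 / 96 * x ^ 4)
  rw [tendsto_iff_dist_tendsto_zero]
  refine squeeze_zero' (.of_forall fun _ => dist_nonneg) ?_ h0
  filter_upwards [hΛ.eventually_ge_atTop (x ^ 2), hΛ.eventually_gt_atTop 0] with i hi hi0
  have h1 : |x / √(Λ i)| ≤ 1 := by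
    rw [abs_div, abs_of_nonneg (sqrt_nonneg _)]
    exact div_le_one_of_le₀ (abs_le_sqrt hi) (sqrt_nonneg _)
  have h2 := cos_bound h1
  have h3 : (x / √(Λ i)) ^ 2 = x ^ 2 / Λ i := by rw [div_pow, sq_sqrt hi0.le]
  have h4 : |x / √(Λ i)| ^ 4 = x ^ 4 / Λ i ^ 2 := by
    rw [show 4 = 2 * 2 by rfl, pow_mul, sq_abs, h3, div_pow]
    ring
  rw [h3, h4] at h2
  rw [Real.dist_eq]
  have h5 : Λ i * (2 - 2 * cos (x / √(Λ i))) - x ^ 2 =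
      -(2 * Λ i) * (cos (x / √(Λ i)) - (1 - x ^ 2 / Λ i / 2)) := by
    field_simp
    ring
  rw [h5, abs_mul, abs_neg, abs_of_pos (by positivity : 0 < 2 * Λ i)]
  refine (mul_le_mul_of_nonneg_left h2 (by positivity)).trans_eq ?_
  field_simp
  ring

theorem integral_limit_kernel {t s z : ℝ} (ht : 0 < t) :
    1 / (2 * (π : ℂ)) * ∫ x : ℝ, ((3 * exp (-((3 * z + x ^ 2) * t)) : ℝ) : ℂ) *
      Complex.exp (-Complex.I * (s * x : ℝ)) = (h3 t s z : ℂ) := by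
  have h1 (x : ℝ) : ((3 * exp (-((3 * z + x ^ 2) * t)) : ℝ) : ℂ) *
      Complex.exp (-Complex.I * (s * x : ℝ)) = 3 * Complex.exp (-3 * z * t) *
        (Complex.exp (Complex.I * (-s) * x) * Complex.exp (-t * x ^ 2)) := by
    push_cast
    rw [mul_assoc, mul_assoc, ← Complex.exp_add, ← Complex.exp_add, ← Complex.exp_add]
    congr 2
    ring
  simp_rw [h1]
  rw [MeasureTheory.integral_const_mul, fourierIntegral_gaussian (by simpa using ht)]
  have h2 : ((π : ℂ) / t) ^ (1 / 2 : ℂ) = (√(π / t) : ℝ) := by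
    rw [sqrt_eq_rpow, Complex.ofReal_cpow (by positivity)]
    push_cast
    rfl
  have h4 : 3 / (2 * √(π * t)) = 1 / (2 * π) * 3 * √(π / t) := by
    rw [sqrt_mul pi_pos.le, sqrt_div pi_pos.le]
    have : 0 < √t := sqrt_pos.2 ht
    have : 0 < √π := sqrt_pos.2 pi_pos
    field_simp
    rw [sq_sqrt pi_pos.le]
  rw [h2, h3, h4, sub_eq_add_neg, exp_add]
  push_cast
  rw [neg_sq, neg_div]
  ring

theorem tendsto_natFloor_add_one_div {ι : Type*} {l : Filter ι} {Λ t : ι → ℝ} {t₀ : ℝ}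
    (hΛ : Tendsto Λ l atTop) (ht : Tendsto t l (𝓝 t₀)) (ht0 : 0 < t₀) :
    Tendsto (fun i => ((⌊Λ i * t i⌋₊ + 1 : ℕ) : ℝ) / Λ i) l (𝓝 t₀) := by
  have h1 : Tendsto (fun i => t i + (Λ i)⁻¹) l (𝓝 t₀) := by
    simpa using ht.add (tendsto_inv_atTop_zero.comp hΛ)
  refine tendsto_of_tendsto_of_tendsto_of_le_of_le' ht h1 ?_ ?_
  · filter_upwards [hΛ.eventually_gt_atTop 0] with i hi
    rw [le_div_iff₀ hi]
    push_cast
    linarith [Nat.lt_floor_add_one (Λ i * t i)]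
  · filter_upwards [hΛ.eventually_gt_atTop 0, ht.eventually (lt_mem_nhds ht0)] with i hi hi2
    rw [div_le_iff₀ hi, add_mul, inv_mul_cancel₀ hi.ne']
    push_cast
    linarith [Nat.floor_le (mul_pos hi hi2).le]

theorem tendsto_floor_div {ι : Type*} {l : Filter ι} {r s : ι → ℝ} {s₀ : ℝ}
    (hr : Tendsto r l atTop) (hs : Tendsto s l (𝓝 s₀)) :
    Tendsto (fun i => (⌊r i * s i⌋ : ℝ) / r i) l (𝓝 s₀) := by
  have h1 : Tendsto (fun i => s i - (r i)⁻¹) l (𝓝 s₀) := by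
    simpa using hs.sub (tendsto_inv_atTop_zero.comp hr)
  refine tendsto_of_tendsto_of_tendsto_of_le_of_le' h1 hs ?_ ?_
  · filter_upwards [hr.eventually_gt_atTop 0] with i hi
    rw [le_div_iff₀ hi, sub_mul, inv_mul_cancel₀ hi.ne']
    linarith [Int.lt_floor_add_one (r i * s i)]
  · filter_upwards [hr.eventually_gt_atTop 0] with i hi
    rw [div_le_iff₀ hi]
    linarith [Int.floor_le (r i * s i)]

theorem scaledGreen_eq {Λ t : ℝ} (h : 0 ≤ Λ * t) (s z : ℝ) :
    scaledGreen Λ t s z = √Λ * g3 (⌊Λ * t⌋₊ : ℕ) ⌊√Λ * s⌋ (1 - z / Λ) := by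
  rw [scaledGreen, Int.natCast_floor_eq_floor h]

/-! ### Joint and uniform convergence -/

theorem tendsto_scaledGreen {t₀ s₀ z₀ : ℝ} (ht0 : 0 < t₀) (hz0 : 0 < z₀) :
    Tendsto (fun q : ℝ × ℝ × ℝ × ℝ => scaledGreen q.1 q.2.1 q.2.2.1 q.2.2.2)
      (atTop ×ˢ 𝓝 (t₀, s₀, z₀)) (𝓝 (h3 t₀ s₀ z₀)) := by
  set l : Filter (ℝ × ℝ × ℝ × ℝ) := atTop ×ˢ 𝓝 (t₀, s₀, z₀)
  have hΛ : Tendsto (fun q : ℝ × ℝ × ℝ × ℝ => q.1) l atTop := tendsto_fst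
  have hp : Tendsto (fun q : ℝ × ℝ × ℝ × ℝ => q.2) l (𝓝 (t₀, s₀, z₀)) := tendsto_snd
  have ht : Tendsto (fun q : ℝ × ℝ × ℝ × ℝ => q.2.1) l (𝓝 t₀) := hp.fst_nhds
  have hs : Tendsto (fun q : ℝ × ℝ × ℝ × ℝ => q.2.2.1) l (𝓝 s₀) := hp.snd_nhds.fst_nhds
  have hz : Tendsto (fun q : ℝ × ℝ × ℝ × ℝ => q.2.2.2) l (𝓝 z₀) := hp.snd_nhds.snd_nhds
  have hinv : Tendsto (fun q : ℝ × ℝ × ℝ × ℝ => q.1⁻¹) l (𝓝 0) :=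
    tendsto_inv_atTop_zero.comp hΛ
  have hsqrt : Tendsto (fun q : ℝ × ℝ × ℝ × ℝ => √q.1) l atTop := tendsto_sqrt_atTop.comp hΛ
  have ha : Tendsto (fun q : ℝ × ℝ × ℝ × ℝ => 1 - q.2.2.2 / q.1) l (𝓝 1) := by
    simpa [div_eq_mul_inv] using (hz.mul hinv).const_sub 1
  have hN := tendsto_natFloor_add_one_div hΛ ht ht0
  have hm := tendsto_floor_div hsqrt hs
  have hev : ∀ᶠ q : ℝ × ℝ × ℝ × ℝ in l, 0 < q.1 ∧ t₀ / 2 < q.2.1 ∧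
      1 / 2 < 1 - q.2.2.2 / q.1 ∧ 1 - q.2.2.2 / q.1 ≤ 1 := by
    filter_upwards [hΛ.eventually_gt_atTop 0, ht.eventually (lt_mem_nhds (half_lt_self ht0)),
      hz.eventually (lt_mem_nhds hz0), ha.eventually (lt_mem_nhds one_half_lt_one)]
      with q h1 h2 h3 h4
    exact ⟨h1, h2, h4, by linarith [div_pos h3 h1]⟩
  have hmain : Tendsto (fun q : ℝ × ℝ × ℝ × ℝ => ∫ x : ℝ,
      (Set.Ioc (-π) π).indicator (fun θ : ℝ =>
        ((3 / (1 - q.2.2.2 / q.1) *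
          ((3 / (1 - q.2.2.2 / q.1) - 2 * cos θ) ^ (⌊q.1 * q.2.1⌋₊ + 1))⁻¹ : ℝ) : ℂ) *
        Complex.exp (-Complex.I * ⌊√q.1 * q.2.2.1⌋ * θ)) (x / √q.1)) l
      (𝓝 (∫ x : ℝ, ((3 * exp (-((3 * z₀ + x ^ 2) * t₀)) : ℝ) : ℂ) *
        Complex.exp (-Complex.I * (s₀ * x : ℝ)))) := by
    -- Near the limit point `a > 1/2`, so `3/a ≤ 6`, and `t > t₀/2`, so `N ≥ Λt₀/2`; hence the
    -- constants 6 and `2t₀/π² = (t₀/2)(4/π²)`.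
    refine MeasureTheory.tendsto_integral_filter_of_dominated_convergence
      (fun x => 6 * (1 + (√(2 * t₀ / π ^ 2) * x) ^ 2)⁻¹) (.of_forall fun q => ?_) ?_ ?_
      (MeasureTheory.ae_of_all _ fun x => ?_)
    · refine Measurable.aestronglyMeasurable ?_
      refine Measurable.comp (g := Set.indicator _ _) ?_ (measurable_id.div_const _)
      refine Measurable.indicator ?_ measurableSet_Ioc
      fun_prop
    · filter_upwards [hev] with q hq
      obtain ⟨hq0, hqt, hqa, hqa1⟩ := hq
      refine MeasureTheory.ae_of_all _ fun x => ?_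
      by_cases hx : x / √q.1 ∈ Set.Ioc (-π) π
      · rw [Set.indicator_of_mem hx, norm_mul, mul_assoc, Complex.norm_exp, Complex.norm_real]
        set a := 1 - q.2.2.2 / q.1
        set N := ⌊q.1 * q.2.1⌋₊ + 1
        have h1 : 3 ≤ 3 / a := by rw [le_div_iff₀ (by linarith)]; linarith
        have h2 : 3 / a ≤ 6 := by rw [div_le_iff₀ (by linarith)]; linarith
        have hθ : |x / √q.1| ≤ π := abs_le.2 ⟨hx.1.le, hx.2⟩
        have h3 := one_add_le_three_sub_pow N le_rfl (by norm_num) hθ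
        have hNq : q.1 * t₀ / 2 ≤ N := by
          have := Nat.lt_floor_add_one (q.1 * q.2.1)
          simp only [N]
          push_cast
          nlinarith
        have h4 : 1 + (√(2 * t₀ / π ^ 2) * x) ^ 2 ≤ (3 / a - 2 * cos (x / √q.1)) ^ N := by
          calc 1 + (√(2 * t₀ / π ^ 2) * x) ^ 2
              = 1 + q.1 * t₀ / 2 * (4 / π ^ 2 * (x / √q.1) ^ 2) := by
                rw [mul_pow, div_pow, sq_sqrt (by positivity), sq_sqrt hq0.le]
                field_simp
                ring
            _ ≤ 1 + N * (4 / π ^ 2 * (x / √q.1) ^ 2) := by gcongr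
            _ ≤ (3 - 2 * cos (x / √q.1)) ^ N := by
                refine le_trans (le_of_eq ?_) (h3.trans_eq ?_)
                · norm_num
                · norm_num
            _ ≤ _ := by
                have := cos_le_one (x / √q.1)
                exact pow_le_pow_left₀ (by linarith) (by linarith) _
        have h5 : 0 < 1 + (√(2 * t₀ / π ^ 2) * x) ^ 2 := by positivity
        rw [Real.norm_of_nonneg (mul_nonneg (by linarith) (inv_nonneg.2 (h5.le.trans h4)))]
        have h6 : (-Complex.I * (⌊√q.1 * q.2.2.1⌋ * ((x / √q.1 : ℝ) : ℂ))).re = 0 := by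
          simp [-Complex.ofReal_div]
        rw [h6, exp_zero, mul_one]
        gcongr
        exact inv_nonneg.2 (h5.le.trans h4)
      · rw [Set.indicator_of_notMem hx, norm_zero]
        positivity
    · refine (integrable_inv_one_add_sq.comp_mul_left' ?_).const_mul 6
      positivity
    -- Split as `Λ(3/a - 3) + Λ(2 - 2 cos)`, where the first term equals `3z/a`.
    · have hw0 : Tendsto (fun q : ℝ × ℝ × ℝ × ℝ =>
          q.1 * (3 / (1 - q.2.2.2 / q.1) - 2 * cos (x / √q.1) - 1)) l (𝓝 (3 * z₀ + x ^ 2)) := by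
        have h1 : Tendsto (fun q : ℝ × ℝ × ℝ × ℝ => 3 * q.2.2.2 / (1 - q.2.2.2 / q.1)) l
            (𝓝 (3 * z₀)) := by
          simpa using! (hz.const_mul 3).div ha one_ne_zero
        refine (h1.add (tendsto_mul_two_sub_cos hΛ x)).congr' ?_
        filter_upwards [hev] with q hq
        have h2 : 1 - q.2.2.2 / q.1 ≠ 0 := by linarith [hq.2.2.1]
        have h3 : q.2.2.2 = q.1 * (1 - (1 - q.2.2.2 / q.1)) := by
          field_simp [hq.1.ne']
          ring
        nth_rewrite 1 [h3]
        field_simp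
        ring
      have hker := tendsto_inv_one_add_pow (l := l)
        (N := fun q => ⌊q.1 * q.2.1⌋₊ + 1)
        (w := fun q => 3 / (1 - q.2.2.2 / q.1) - 2 * cos (x / √q.1) - 1)
        (y := (3 * z₀ + x ^ 2) * t₀) ?_ ?_ ?_
      · have hexp : Tendsto (fun q : ℝ × ℝ × ℝ × ℝ => Complex.exp (-Complex.I *
            ((⌊√q.1 * q.2.2.1⌋ / √q.1 * x : ℝ) : ℂ))) l
            (𝓝 (Complex.exp (-Complex.I * (s₀ * x : ℝ)))) := by
          refine (Complex.continuous_exp.tendsto _).comp (Tendsto.const_mul _ ?_)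
          exact (Complex.continuous_ofReal.tendsto _).comp (hm.mul_const x)
        have hreal : Tendsto (fun q : ℝ × ℝ × ℝ × ℝ => ((3 / (1 - q.2.2.2 / q.1) *
            ((1 + (3 / (1 - q.2.2.2 / q.1) - 2 * cos (x / √q.1) - 1)) ^
              (⌊q.1 * q.2.1⌋₊ + 1))⁻¹ : ℝ) : ℂ)) l
            (𝓝 ((3 * exp (-((3 * z₀ + x ^ 2) * t₀)) : ℝ) : ℂ)) := by
          refine (Complex.continuous_ofReal.tendsto _).comp (Tendsto.mul ?_ hker)
          simpa using! (tendsto_const_nhds (x := (3 : ℝ))).div ha one_ne_zero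
        refine (hreal.mul hexp).congr' ?_
        have hxs : Tendsto (fun q : ℝ × ℝ × ℝ × ℝ => x / √q.1) l (𝓝 0) := by
          simpa [div_eq_mul_inv] using (tendsto_inv_atTop_zero.comp hsqrt).const_mul x
        filter_upwards [hxs.eventually (Ioo_mem_nhds (neg_lt_zero.2 pi_pos) pi_pos)] with q hq
        rw [Set.indicator_of_mem (Set.Ioo_subset_Ioc_self hq), add_sub_cancel]
        congr 2
        push_cast
        ring
      · filter_upwards [hev] with q hq
        have h1 : 3 ≤ 3 / (1 - q.2.2.2 / q.1) := by
          rw [le_div_iff₀ (by linarith [hq.2.2.1])]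
          linarith [hq.2.2.2]
        linarith [cos_le_one (x / √q.1)]
      · refine Tendsto.congr' ?_ (by simpa using hinv.mul hw0)
        filter_upwards [hev] with q hq
        rw [inv_mul_cancel_left₀ hq.1.ne']
      · refine Tendsto.congr' ?_ (by simpa [mul_comm] using hN.mul hw0)
        filter_upwards [hev] with q hq
        have := hq.1.ne'
        push_cast
        field_simp
  have hC := hmain.const_mul (1 / (2 * (π : ℂ)))
  rw [integral_limit_kernel ht0] at hC
  have hR := (Complex.continuous_re.tendsto _).comp hC
  rw [Complex.ofReal_re] at hR
  refine hR.congr' ?_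
  filter_upwards [hev] with q hq
  obtain ⟨hq0, hqt, hqa, hqa1⟩ := hq
  rw [Function.comp_apply, ← sqrt_mul_g3_eq_integral _ _ (by linarith) hqa1, Complex.ofReal_re,
    scaledGreen_eq (by nlinarith)]

theorem continuousAt_h3 {t s z : ℝ} (ht : 0 < t) :
    ContinuousAt (fun p : ℝ × ℝ × ℝ => h3 p.1 p.2.1 p.2.2) (t, s, z) := by
  unfold h3
  have h1 : 2 * √(π * t) ≠ 0 := by positivity
  have h2 : 4 * t ≠ 0 := by positivity
  fun_prop (disch := assumption)

theorem tendstoUniformlyOn_scaledGreen {K : Set (ℝ × ℝ × ℝ)} (hK : IsCompact K)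
    (hpos : ∀ p ∈ K, 0 < p.1 ∧ 0 < p.2.2) :
    TendstoUniformlyOn (fun (Λ : ℝ) (p : ℝ × ℝ × ℝ) => scaledGreen Λ p.1 p.2.1 p.2.2)
      (fun p : ℝ × ℝ × ℝ => h3 p.1 p.2.1 p.2.2) atTop K := by
  rw [← tendstoLocallyUniformlyOn_iff_tendstoUniformlyOn_of_compact hK,
    tendstoLocallyUniformlyOn_iff_filter]
  rintro ⟨t, s, z⟩ hp
  obtain ⟨ht, hz⟩ := hpos _ hp
  rw [tendstoUniformlyOnFilter_iff_tendsto]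
  refine Tendsto.mono_left ?_ (Filter.prod_mono le_rfl nhdsWithin_le_nhds)
  refine Tendsto.mono_right ?_ (nhds_le_uniformity (h3 t s z))
  exact ((continuousAt_h3 (s := s) (z := z) ht).tendsto.comp tendsto_snd).prodMk_nhds
    (tendsto_scaledGreen ht hz)

/-! ### The upper bound by contour shift -/

theorem summable_stepProb (n : ℕ) (m : ℤ) : Summable fun k : ℕ => stepProb k n m := by
  have h := (hasSum_pow_mul_stepProb n m (a := 1) (v := 0) zero_le_one le_rfl
    (by norm_num)).summable
  simp only [one_pow, one_mul] at h
  exact_mod_cast h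

theorem g3_le_pow_mul (n : ℕ) (m : ℤ) {a : ℝ} (ha0 : 0 ≤ a) (ha1 : a ≤ 1) :
    g3 n m a ≤ a ^ n * ∑' k : ℕ, stepProb k n m := by
  have hle (k : ℕ) : a ^ k * stepProb k n m ≤ a ^ n * stepProb k n m := by
    rcases lt_or_ge k n with h | h
    · simp [stepProb_of_lt m h]
    · exact mul_le_mul_of_nonneg_right (pow_le_pow_of_le_one ha0 ha1 h) (stepProb_nonneg _ _ _)
  have hs := (summable_stepProb n m).mul_left (a ^ n)
  rw [g3, ← tsum_mul_left]
  exact (Summable.of_nonneg_of_le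
    (fun k => mul_nonneg (pow_nonneg ha0 k) (stepProb_nonneg _ _ _)) hle hs).tsum_le_tsum hle hs

theorem re_cos_add_mul_I (θ v : ℝ) :
    (Complex.cos (θ + v * Complex.I)).re = cosh v * cos θ := by
  have h : Complex.cos (θ + v * Complex.I) =
      ((cosh v * cos θ : ℝ) : ℂ) - ((sin θ * sinh v : ℝ) : ℂ) * Complex.I := by
    rw [Complex.cos_add_mul_I]
    push_cast
    ring
  rw [h, Complex.sub_re, Complex.ofReal_re, Complex.re_ofReal_mul, Complex.I_re, mul_zero,
    sub_zero]

theorem integral_inv_one_add_mul_sq {κ : ℝ} (hκ : 0 < κ) :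
    ∫ x : ℝ, (1 + κ * x ^ 2)⁻¹ = π / √κ := by
  have h : (fun x : ℝ => (1 + κ * x ^ 2)⁻¹) = fun x => (1 + (√κ * x) ^ 2)⁻¹ := by
    ext x
    rw [mul_pow, sq_sqrt hκ.le]
  rw [h, MeasureTheory.Measure.integral_comp_mul_left (fun x : ℝ => (1 + x ^ 2)⁻¹),
    integral_univ_inv_one_add_sq, abs_of_nonneg (by positivity), smul_eq_mul]
  ring

/-- At height `u` the exponential has modulus `exp(mu)`, and the denominator is bounded below by its
real part `(3 - 2 cosh u cos θ)/3`. Integrating the resulting `(1 + κθ²)⁻¹` over the line produces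
`1/√(n+1)`. -/
theorem tsum_stepProb_le_of_cosh_lt (n : ℕ) (m : ℤ) {u : ℝ} (hu : 2 * cosh u < 3) :
    ∑' k : ℕ, stepProb k n m ≤
      3 / √(n + 1) * exp (m * u) * ((3 - 2 * cosh u) ^ (n + 1))⁻¹ := by
  have h := (hasSum_pow_mul_stepProb n m (a := 1) zero_le_one le_rfl hu).tsum_eq
  simp only [one_pow, one_mul, ← Complex.ofReal_tsum, Complex.ofReal_one] at h
  have h0 : 0 ≤ ∑' k : ℕ, stepProb k n m := tsum_nonneg fun k => stepProb_nonneg _ _ _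
  set κ : ℝ := (n + 1) * (4 / π ^ 2) with hκ
  have hκ0 : 0 < κ := by positivity
  have hint : MeasureTheory.Integrable fun x : ℝ => (1 + κ * x ^ 2)⁻¹ := by
    refine (integrable_inv_one_add_sq.comp_mul_left' (R := √κ) (by positivity)).congr ?_
    refine MeasureTheory.ae_of_all _ fun x => ?_
    simp only [mul_pow, sq_sqrt hκ0.le]
  have hpos : 0 < 3 - 2 * cosh u := by linarith
  set B : ℝ := 3 * exp (m * u) * ((3 - 2 * cosh u) ^ (n + 1))⁻¹ with hB
  have hB0 : 0 ≤ B := by positivity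
  have hbound (θ : ℝ) (hθ : |θ| ≤ π) : ‖((1 : ℂ) / 3) ^ n /
        (1 - 1 / 3 * (2 * Complex.cos (θ + u * Complex.I))) ^ (n + 1) *
          Complex.exp (-Complex.I * m * (θ + u * Complex.I))‖ ≤
      B * (1 + κ * θ ^ 2)⁻¹ := by
    have h1 := one_add_le_three_sub_pow (n + 1) (one_le_cosh u) hu hθ
    have h1' : (3 - 2 * cosh u) ^ (n + 1) * (1 + κ * θ ^ 2) ≤
        (3 - 2 * cosh u * cos θ) ^ (n + 1) := by
      refine le_trans (le_of_eq ?_) h1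
      rw [hκ]
      push_cast
      ring
    have h2 : (3 - 2 * cosh u * cos θ) / 3 ≤
        ‖(1 : ℂ) - 1 / 3 * (2 * Complex.cos (θ + u * Complex.I))‖ := by
      refine le_trans (le_of_eq ?_) (Complex.re_le_norm _)
      have : (1 : ℂ) - 1 / 3 * (2 * Complex.cos (θ + u * Complex.I)) =
        1 - ((2 / 3 : ℝ) : ℂ) * Complex.cos (θ + u * Complex.I) := by
          push_cast
          ring
      rw [this, Complex.sub_re, Complex.re_ofReal_mul, re_cos_add_mul_I, Complex.one_re]
      ring
    have h3 : 0 < 3 - 2 * cosh u * cos θ := by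
      nlinarith [cos_le_one θ, one_le_cosh u]
    have h4 : (3 - 2 * cosh u) ^ (n + 1) * (1 + κ * θ ^ 2) / 3 ^ (n + 1) ≤
        ‖(1 : ℂ) - 1 / 3 * (2 * Complex.cos (θ + u * Complex.I))‖ ^ (n + 1) := by
      calc _ ≤ (3 - 2 * cosh u * cos θ) ^ (n + 1) / 3 ^ (n + 1) := by gcongr
        _ = ((3 - 2 * cosh u * cos θ) / 3) ^ (n + 1) := by rw [div_pow]
        _ ≤ _ := by gcongr
    rw [norm_mul, norm_div, norm_pow, norm_pow, norm_cexp_neg_I_mul]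
    have h5 : ‖(1 : ℂ) / 3‖ = 1 / 3 := by simp
    rw [h5]
    have h6 : 0 < (3 - 2 * cosh u) ^ (n + 1) * (1 + κ * θ ^ 2) / 3 ^ (n + 1) := by positivity
    calc (1 / 3 : ℝ) ^ n / ‖(1 : ℂ) - 1 / 3 * (2 * Complex.cos (θ + u * Complex.I))‖ ^ (n + 1) *
          exp (m * u)
        ≤ (1 / 3 : ℝ) ^ n / ((3 - 2 * cosh u) ^ (n + 1) * (1 + κ * θ ^ 2) / 3 ^ (n + 1)) *
          exp (m * u) := by gcongr
      _ = _ := by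
        rw [hB, pow_succ 3, one_div, inv_pow]
        field_simp
  have hle : -π ≤ π := by linarith [pi_pos]
  have hnorm := intervalIntegral.norm_integral_le_of_norm_le hle (f := fun θ : ℝ =>
      ((1 : ℂ) / 3) ^ n / (1 - 1 / 3 * (2 * Complex.cos (θ + u * Complex.I))) ^ (n + 1) *
          Complex.exp (-Complex.I * m * (θ + u * Complex.I)))
      (MeasureTheory.ae_of_all _ fun θ hθ => hbound θ (abs_le.2 ⟨hθ.1.le, hθ.2⟩))
      ((hint.const_mul B).intervalIntegrable)
  have hI : ∫ θ in -π..π, B * (1 + κ * θ ^ 2)⁻¹ ≤ B * (π / √κ) := by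
    rw [intervalIntegral.integral_const_mul, intervalIntegral.integral_of_le hle,
      ← integral_inv_one_add_mul_sq hκ0]
    refine mul_le_mul_of_nonneg_left ?_ hB0
    exact MeasureTheory.setIntegral_le_integral hint
      (MeasureTheory.ae_of_all _ fun x => by positivity)
  have hsum : ∑' k : ℕ, stepProb k n m ≤ 1 / (2 * π) * (B * (π / √κ)) := by
    have h7 := congrArg norm h
    rw [Complex.norm_real, Real.norm_of_nonneg h0, norm_mul] at h7
    rw [h7]
    have h8 : ‖(1 : ℂ) / (2 * π)‖ = 1 / (2 * π) := by
      simp [abs_of_pos pi_pos]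
    rw [h8]
    exact mul_le_mul_of_nonneg_left (hnorm.trans hI) (by positivity)
  refine hsum.trans ?_
  have h9 : √κ = √(n + 1) * (2 / π) := by
    rw [hκ, sqrt_mul (by positivity), show 4 / π ^ 2 = (2 / π) ^ 2 by ring,
      sqrt_sq (by positivity)]
  have h10 : 1 / (2 * π) * (B * (π / √κ)) = π / 4 * (B / √(n + 1)) := by
    rw [h9]
    field_simp
    ring
  rw [h10]
  refine (mul_le_of_le_one_left (by positivity) (by linarith [pi_le_four])).trans_eq ?_
  rw [hB]
  ring

theorem inv_three_sub_two_cosh_le {u : ℝ} (hu : |u| ≤ 1 / 2) :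
    2 * cosh u < 3 ∧ (3 - 2 * cosh u)⁻¹ ≤ exp (2 * u ^ 2) := by
  set y := u ^ 2 / 2 with hy
  have hy0 : 0 ≤ y := by positivity
  have hy1 : y ≤ 1 / 8 := by
    have := sq_abs u
    nlinarith [abs_nonneg u]
  have h1 : cosh u ≤ 1 + y + y ^ 2 := by
    refine (cosh_le_exp_half_sq u).trans ?_
    have := (abs_le.1 (abs_exp_sub_one_sub_id_le (x := y) (by
      rw [abs_of_nonneg hy0]; linarith))).2
    linarith
  have h2 : 0 < 3 - 2 * cosh u := by nlinarith
  refine ⟨by linarith, ?_⟩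
  rw [inv_le_iff_one_le_mul₀ h2, show 2 * u ^ 2 = 4 * y by rw [hy]; ring]
  have h3 := add_one_le_exp (4 * y)
  calc (1 : ℝ) ≤ (4 * y + 1) * (1 - 2 * y - 2 * y ^ 2) := by nlinarith [pow_nonneg hy0 3]
    _ ≤ exp (4 * y) * (3 - 2 * cosh u) := by
      refine mul_le_mul h3 (by linarith) ?_ (exp_pos _).le
      nlinarith

theorem tsum_stepProb_le (n : ℕ) (m : ℤ) {u : ℝ} (hu0 : 0 ≤ u) (hu : u ≤ 1 / 2) :
    ∑' k : ℕ, stepProb k n m ≤ 3 / √(n + 1) * exp (-u * |(m : ℝ)| + 2 * u ^ 2 * (n + 1)) := by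
  -- Shift the contour to the side on which `exp(mv)` decays.
  obtain ⟨v, hv, hmv⟩ : ∃ v : ℝ, |v| = u ∧ m * v = -u * |(m : ℝ)| := by
    rcases le_total 0 (m : ℝ) with h | h
    · exact ⟨-u, by rw [abs_neg, abs_of_nonneg hu0], by rw [abs_of_nonneg h]; ring⟩
    · exact ⟨u, abs_of_nonneg hu0, by rw [abs_of_nonpos h]; ring⟩
  obtain ⟨h1, h2⟩ := inv_three_sub_two_cosh_le (hv.trans_le hu)
  refine (tsum_stepProb_le_of_cosh_lt n m h1).trans ?_
  rw [← sq_abs, hv] at h2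
  rw [exp_add, hmv, ← mul_assoc, ← inv_pow]
  refine mul_le_mul_of_nonneg_left ?_ (by positivity)
  refine (pow_le_pow_left₀ (inv_nonneg.2 (by linarith)) h2 _).trans_eq ?_
  rw [← exp_nat_mul]
  push_cast
  ring_nf

theorem rpow_le_one_add {x p : ℝ} (hx : 0 ≤ x) (hp0 : 0 ≤ p) (hp1 : p ≤ 1) : x ^ p ≤ 1 + x := by
  rcases le_total x 1 with h | h
  · linarith [rpow_le_one hx h hp0]
  · have := rpow_le_rpow_of_exponent_le h hp1
    rw [rpow_one] at this
    linarith

/-- Three regimes. For `M > 2(n+1)` the largest shift `u = 1/2` gives exponential decay in `T +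
|S|`, stronger than the stretched exponential. For smaller `M`, if `T < 1` everything is bounded and
`u = 0` suffices; otherwise the optimal shift gives the Gaussian term. -/
theorem tsum_stepProb_floor_le {T : ℝ} (hT : 0 < T) (S : ℝ) :
    ∑' k : ℕ, stepProb k ⌊T⌋₊ ⌊S⌋ ≤ 3 * exp 1 * (1 / √T * exp (-(S ^ 2 / (16 * T))) +
      exp (-(1 / 8 * T ^ (1 / 3 : ℝ)) - 1 / 8 * |S| ^ (1 / 2 : ℝ))) := by
  set n := ⌊T⌋₊ with hn
  set M : ℝ := |(⌊S⌋ : ℝ)| with hM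
  have hn1 : (n : ℝ) ≤ T := Nat.floor_le hT.le
  have hn2 : T < n + 1 := Nat.lt_floor_add_one T
  have hn0 : (0 : ℝ) ≤ n := n.cast_nonneg
  have hM0 : 0 ≤ M := abs_nonneg _
  have hSM : |S| ≤ M + 1 := by
    have h1 := Int.floor_le S
    have h2 := Int.lt_floor_add_one S
    have h3 : |S - ⌊S⌋| ≤ 1 := abs_le.2 ⟨by linarith, by linarith⟩
    have h4 := abs_add_le (S - ⌊S⌋) (⌊S⌋ : ℝ)
    rw [sub_add_cancel] at h4
    linarith
  have hA : 0 ≤ 1 / √T * exp (-(S ^ 2 / (16 * T))) := by positivity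
  have hr1 := rpow_le_one_add hT.le (p := 1 / 3) (by norm_num) (by norm_num)
  have hr2 := rpow_le_one_add (abs_nonneg S) (p := 1 / 2) (by norm_num) (by norm_num)
  have hfar {y : ℝ} (hy : y ≤ 1 - 1 / 8 * (2 + T + |S|)) : exp y ≤
      exp 1 * exp (-(1 / 8 * T ^ (1 / 3 : ℝ)) - 1 / 8 * |S| ^ (1 / 2 : ℝ)) := by
    rw [← exp_add]
    refine exp_le_exp.2 ?_
    linarith
  have hsqrt : 3 / √((n : ℝ) + 1) ≤ 3 :=
    div_le_self (by norm_num) (one_le_sqrt.2 (by linarith))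
  have hfar' {y : ℝ} (hy : y ≤ 1 - 1 / 8 * (2 + T + |S|)) : 3 / √((n : ℝ) + 1) * exp y ≤
      3 * exp 1 * (1 / √T * exp (-(S ^ 2 / (16 * T))) +
        exp (-(1 / 8 * T ^ (1 / 3 : ℝ)) - 1 / 8 * |S| ^ (1 / 2 : ℝ))) := by
    have h1 := mul_le_mul hsqrt (hfar hy) (exp_pos _).le zero_le_three
    have h2 := mul_nonneg (by positivity : 0 ≤ 3 * exp 1) hA
    linarith
  rcases lt_or_ge (2 * ((n : ℝ) + 1)) M with hMn | hMn
  · refine (tsum_stepProb_le n ⌊S⌋ (u := 1 / 2) (by norm_num) le_rfl).trans (hfar' ?_)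
    rw [← hM]
    linarith
  rcases lt_or_ge T 1 with hT1 | hT1
  · have h0 : (n : ℝ) = 0 := by
      rw [hn, Nat.floor_eq_zero.2 hT1, Nat.cast_zero]
    refine (tsum_stepProb_le n ⌊S⌋ (u := 0) le_rfl (by norm_num)).trans (hfar' ?_)
    rw [h0] at hMn
    linarith
  -- `u = M/(4(n+1))` minimises `-uM + 2u²(n+1)`.
  · have hu : M / (4 * (n + 1)) ≤ 1 / 2 := by
      rw [div_le_iff₀ (by positivity)]
      linarith
    refine (tsum_stepProb_le n ⌊S⌋ (by positivity) hu).trans ?_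
    rw [← hM]
    have h1 : -(M / (4 * (n + 1))) * M + 2 * (M / (4 * (n + 1))) ^ 2 * (n + 1) =
        -(M ^ 2 / (8 * (n + 1))) := by
      field_simp
      ring
    -- `T ≥ 1` gives `n + 1 ≤ 2T`, the source of the 16; the summand 1 pays for replacing `|S|` by
    -- `M + 1`.
    have h2 : S ^ 2 / (16 * T) ≤ M ^ 2 / (8 * (n + 1)) + 1 := by
      calc S ^ 2 / (16 * T) ≤ (M + 1) ^ 2 / (8 * (n + 1)) := by
            rw [← sq_abs S]
            exact div_le_div₀ (by positivity) (pow_le_pow_left₀ (abs_nonneg _) hSM 2)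
              (by positivity) (by linarith)
        _ ≤ _ := by
            rw [div_add_one (by positivity)]
            gcongr
            nlinarith
    have h3 : 3 / √((n : ℝ) + 1) ≤ 3 * (1 / √T) := by
      rw [mul_one_div]
      gcongr
    have h4 : exp (-(M ^ 2 / (8 * (n + 1)))) ≤ exp 1 * exp (-(S ^ 2 / (16 * T))) := by
      rw [← exp_add]
      exact exp_le_exp.2 (by linarith)
    rw [h1]
    refine (mul_le_mul h3 h4 (exp_pos _).le (by positivity)).trans ?_
    have h5 : 0 ≤ 3 * exp 1 * exp (-(1 / 8 * T ^ (1 / 3 : ℝ)) - 1 / 8 * |S| ^ (1 / 2 : ℝ)) := by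
      positivity
    linarith

theorem scaledGreen_lt {Λ t z : ℝ} (ht : 0 < t) (s : ℝ) (hz : 0 < z) (hzΛ : z < Λ) :
    scaledGreen Λ t s z < 4 * exp 2 * (h3bar t s z +
      √Λ * exp (-z * t - 1 / 8 * (Λ * t) ^ (1 / 3 : ℝ) -
        1 / 8 * (√Λ * |s|) ^ (1 / 2 : ℝ))) := by
  have hΛ : 0 < Λ := hz.trans hzΛ
  have hT : 0 < Λ * t := mul_pos hΛ ht
  set X := h3bar t s z + √Λ * exp (-z * t - 1 / 8 * (Λ * t) ^ (1 / 3 : ℝ) -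
        1 / 8 * (√Λ * |s|) ^ (1 / 2 : ℝ)) with hX
  have hX0 : 0 < X := by
    rw [hX, h3bar]
    positivity
  have hzle : z / Λ ≤ 1 := (div_le_one hΛ).2 hzΛ.le
  have hz0 : 0 < z / Λ := div_pos hz hΛ
  -- The floor loses at most `z/Λ ≤ 1` in the exponent.
  have hpow : (1 - z / Λ) ^ ⌊Λ * t⌋₊ ≤ exp 1 * exp (-z * t) := by
    refine (pow_le_pow_left₀ (by linarith) (one_sub_le_exp_neg (z / Λ)) _).trans ?_
    rw [← exp_nat_mul, ← exp_add]
    refine exp_le_exp.2 ?_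
    have h1 := Nat.lt_floor_add_one (Λ * t)
    have h2 : z * t = z / Λ * (Λ * t) := by field_simp
    nlinarith
  have hG := tsum_stepProb_floor_le hT (√Λ * s)
  have hG0 : 0 ≤ ∑' k : ℕ, stepProb k ⌊Λ * t⌋₊ ⌊√Λ * s⌋ :=
    tsum_nonneg fun k => stepProb_nonneg _ _ _
  have hg := (g3_le_pow_mul ⌊Λ * t⌋₊ ⌊√Λ * s⌋ (a := 1 - z / Λ) (by linarith)
    (by linarith)).trans (mul_le_mul hpow hG hG0 (by positivity))
  have habs : |√Λ * s| = √Λ * |s| := by rw [abs_mul, abs_of_nonneg (sqrt_nonneg _)]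
  have hsq : (√Λ * s) ^ 2 / (16 * (Λ * t)) = s ^ 2 / (16 * t) := by
    rw [mul_pow, sq_sqrt hΛ.le]
    field_simp
  have hbar : h3bar t s z = √Λ * (1 / √(Λ * t) * (exp (-z * t) * exp (-(s ^ 2 / (16 * t))))) := by
    rw [h3bar, ← exp_add, sqrt_mul hΛ.le, sub_eq_add_neg]
    have : 0 < √Λ := sqrt_pos.2 hΛ
    field_simp
  -- Since `X > 0`, the constant 3 here against 4 in the goal yields strictness.
  have hle : scaledGreen Λ t s z ≤ 3 * exp 2 * X := by
    rw [scaledGreen_eq hT.le]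
    refine (mul_le_mul_of_nonneg_left hg (sqrt_nonneg Λ)).trans_eq ?_
    rw [hX, hbar, habs, hsq, sub_sub, sub_eq_add_neg (-z * t), exp_add (-z * t), neg_add,
      ← sub_eq_add_neg, show (2 : ℝ) = 1 + 1 by norm_num, exp_add 1 1]
    ring_nf
  have := mul_pos (exp_pos 2) hX0
  linarith

end ThreeN

theorem mainTheorem5 :
    (∀ t s z : ℝ, 0 < t → 0 < z →
      Tendsto (fun Λ : ℝ => ThreeN.scaledGreen Λ t s z) atTop (𝓝 (ThreeN.h3 t s z))) ∧
    (∀ ε : ℝ, 0 < ε →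
      TendstoUniformlyOn
        (fun (Λ : ℝ) (p : ℝ × ℝ × ℝ) => ThreeN.scaledGreen Λ p.1 p.2.1 p.2.2)
        (fun p : ℝ × ℝ × ℝ => ThreeN.h3 p.1 p.2.1 p.2.2) atTop
        {p : ℝ × ℝ × ℝ | (ε < p.1 ∧ p.1 < 1 / ε) ∧ (ε < |p.2.1| ∧ |p.2.1| < 1 / ε) ∧
          (ε < p.2.2 ∧ p.2.2 < 1 / ε)}) ∧
    (∃ C c : ℝ, 0 < C ∧ 0 < c ∧ ∀ᶠ Λ : ℝ in atTop, ∀ t s z : ℝ, 0 < t → 0 < z → z < Λ →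
      ThreeN.scaledGreen Λ t s z <
        C * (ThreeN.h3bar t s z +
          √Λ * exp (-z * t - c * (Λ * t) ^ (1 / 3 : ℝ) - c * (√Λ * |s|) ^ (1 / 2 : ℝ)))) := by
  refine ⟨fun t s z ht hz => ?_, fun ε hε => ?_, 4 * exp 2, 1 / 8, by positivity, by norm_num,
    .of_forall fun Λ t s z ht hz hzΛ => ThreeN.scaledGreen_lt ht s hz hzΛ⟩
  · exact (ThreeN.tendsto_scaledGreen ht hz).comp (tendsto_id.prodMk tendsto_const_nhds)
  -- The set lies in a compact box on which `t` and `z` stay at least `ε`.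
  · refine (ThreeN.tendstoUniformlyOn_scaledGreen
      (K := Set.Icc ε (1 / ε) ×ˢ Set.Icc (-(1 / ε)) (1 / ε) ×ˢ Set.Icc ε (1 / ε))
      (isCompact_Icc.prod (isCompact_Icc.prod isCompact_Icc)) fun p hp =>
        ⟨hε.trans_le hp.1.1, hε.trans_le hp.2.2.1⟩).mono ?_
    rintro p ⟨⟨h1, h2⟩, ⟨-, h3⟩, h4, h5⟩
    exact ⟨⟨h1.le, h2.le⟩, abs_le.1 h3.le, h4.le, h5.le⟩
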